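/- Fix $a\in(-1,1)$ and let $\sigma_a(x)=x$ for $x\ge 0$, $\sigma_a(x)=ax$ for $x<0$. A depth-$L$ network ($L\ge1$) with parameters $\mathbf W=(W_1,b_1,\dots,W_L,b_L)$ and arbitrary finite hidden widths represents $f_{\mathbf W}(x)=\tilde\alpha_L(x)$, where $\alpha_0(x)=x$, $\tilde\alpha_\ell(x)=W_\ell\alpha_{\ell-1}(x)+b_\ell$, $\alpha_\ell(x)=\sigma_a(\tilde\alpha_\ell(x))$ entrywise. For a set $\Omega\subset\mathbb R^n$ and $f:\mathbb R^n\to\mathbb R^m$ let $$R(f;\Omega,\sigma_a,L)=\inf\Big\{\sum_{\ell=1}^L\big(\|W_\ell\|_F^2+\|b_\ell\|^2\big)\;:\;f_{\mathbf W}=f\text{ on }\Omega\Big\}\in[0,\infty]$$ (infimum over all depth-$L$ networks, of any widths; $\inf\emptyset=\infty$), and $$\underline R_\infty(f;\Omega)=\liminf_{L\to\infty}\frac{R(f;\Omega,\sigma_a,L)}{L},\qquad \overline R_\infty(f;\Omega)=\limsup_{L\to\infty}\frac{R(f;\Omega,\sigma_a,L)}{L};$$ when these agree, their common value is the limit $R_\infty(f;\Omega)=\lim_{L\to\infty}R(f;\Omega,\sigma_a,L)/L$.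 A finite piecewise linear function (FPLF) is a continuous function $\mathbb R^n\to\mathbb R^m$ that is affine on each of finitely many closed convex polyhedra covering $\mathbb R^n$. For an FPLF $f$, the Jacobian rank $\mathrm{Rank}_J(f;\Omega)$ is the maximum of $\mathrm{Rank}\,Jf(x)$ over the points $x\in\Omega$ where $f$ is differentiable, and the bottleneck rank $\mathrm{Rank}_{BN}(f;\Omega)$ is the smallest $k\in\mathbb N$ such that $f=g\circ h$ on $\Omega$ for some FPLFs $h:\mathbb R^n\to\mathbb R^k$, $g:\mathbb R^k\to\mathbb R^m$. **Theorem.** Let $\Omega\subset\mathbb R^n$ be non-empty, open and bounded. 0. For every FPLF $f:\mathbb R^n\to\mathbb R^m$, $$\mathrm{Rank}_J(f;\Omega)\le\underline R_\infty(f;\Omega)\le\overline R_\infty(f;\Omega)\le\mathrm{Rank}_{BN}(f;\Omega).$$ 1. For all FPLFs $g:\mathbb R^n\to\mathbb R^k$, $f:\mathbb R^k\to\mathbb R^m$, $$\underline R_\infty(f\circ g;\Omega)\le\min\{\underline R_\infty(f;g(\Omega)),\underline R_\infty(g;\Omega)\},\qquad \overline R_\infty(f\circ g;\Omega)\le\min\{\overline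 R_\infty(f;g(\Omega)),\overline R_\infty(g;\Omega)\}.$$ 2. For all FPLFs $f,g:\mathbb R^n\to\mathbb R^m$, $$\underline R_\infty(f+g;\Omega)\le\underline R_\infty(f;\Omega)+\overline R_\infty(g;\Omega),\qquad \overline R_\infty(f+g;\Omega)\le\overline R_\infty(f;\Omega)+\overline R_\infty(g;\Omega).$$ 3. If $f(x)=Ax+b$ is affine, then the limit $R_\infty(f;\Omega)=\lim_{L\to\infty}R(f;\Omega,\sigma_a,L)/L$ exists and equals $\mathrm{Rank}\,A$. In particular, whenever the limits $R_\infty$ exist, $\mathrm{Rank}_J(f;\Omega)\le R_\infty(f;\Omega)\le\mathrm{Rank}_{BN}(f;\Omega)$, $R_\infty(f\circ g;\Omega)\le\min\{R_\infty(f;g(\Omega)),R_\infty(g;\Omega)\}$ and $R_\infty(f+g;\Omega)\le R_\infty(f;\Omega)+R_\infty(g;\Omega)$. -/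

import Mathlib

open Filter Topology
open scoped ENNReal Matrix

noncomputable section

/-- The homogeneous nonlinearity `σ_a`: the identity on `x ≥ 0`, multiplication by `a` on `x < 0`. -/
def leaky (a x : ℝ) : ℝ := if 0 ≤ x then x else a * x

/-- The parameters `(W₁, b₁, …, W_L, b_L)` of a fully connected network with input dimension `n`,
output dimension `m` and depth `L ≥ 1`; the hidden widths are arbitrary (there is no network of
depth `0`). `layer W b N` puts the layer `(W, b)` in front of the network `N`. -/
inductive Net : ℕ → ℕ → ℕ → Type
  | output {n m : ℕ} (W : Matrix (Fin m) (Fin n) ℝ) (b : Fin m → ℝ) : Net n m 1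
  | layer {n k m L : ℕ} (W : Matrix (Fin k) (Fin n) ℝ) (b : Fin k → ℝ) (N : Net k m L) :
      Net n m (L + 1)

/-- The network function: the pre-activations of the last layer (the nonlinearity `σ_a` is applied
entrywise after every layer but the last). -/
def Net.eval (a : ℝ) : {n m L : ℕ} → Net n m L → (Fin n → ℝ) → (Fin m → ℝ)
  | _, _, _, .output W b, x => W *ᵥ x + b
  | _, _, _, .layer W b N, x => N.eval a (fun i => leaky a ((W *ᵥ x + b) i))

/-- The squared Euclidean norm of all the parameters, weights and biases. -/
def Net.sqNorm : {n m L : ℕ} → Net n m L → ℝ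
  | _, _, _, .output W b => (∑ i, ∑ j, W i j ^ 2) + ∑ i, b i ^ 2
  | _, _, _, .layer W b N => (∑ i, ∑ j, W i j ^ 2) + (∑ i, b i ^ 2) + N.sqNorm

/-- The representation cost `R(f; Ω, σ_a, L)`: the least squared parameter norm of a depth `L`
network, with any finite widths, that equals `f` on `Ω`; it is `∞` if there is none. -/
def repCost {n m : ℕ} (a : ℝ) (Ω : Set (Fin n → ℝ)) (f : (Fin n → ℝ) → (Fin m → ℝ)) (L : ℕ) :
    ℝ≥0∞ :=
  ⨅ (N : Net n m L) (_ : ∀ x ∈ Ω, N.eval a x = f x), ENNReal.ofReal N.sqNorm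

/-- The lower limit of `R(f; Ω, σ_a, L) / L` as `L → ∞`. -/
def lowerLimitCost {n m : ℕ} (a : ℝ) (Ω : Set (Fin n → ℝ)) (f : (Fin n → ℝ) → (Fin m → ℝ)) :
    ℝ≥0∞ :=
  liminf (fun L : ℕ => repCost a Ω f L / (L : ℝ≥0∞)) atTop

/-- The upper limit of `R(f; Ω, σ_a, L) / L` as `L → ∞`. -/
def upperLimitCost {n m : ℕ} (a : ℝ) (Ω : Set (Fin n → ℝ)) (f : (Fin n → ℝ) → (Fin m → ℝ)) :
    ℝ≥0∞ :=
  limsup (fun L : ℕ => repCost a Ω f L / (L : ℝ≥0∞)) atTop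

/-- A closed convex polyhedron: the solution set of finitely many affine inequalities. -/
def IsPolyhedron {n : ℕ} (P : Set (Fin n → ℝ)) : Prop :=
  ∃ (k : ℕ) (C : Matrix (Fin k) (Fin n) ℝ) (d : Fin k → ℝ), P = {x | ∀ i, (C *ᵥ x) i ≤ d i}

/-- Finite piecewise linear functions: continuous, and affine on each of finitely many polyhedra
that cover the space. -/
def IsFPLF {n m : ℕ} (f : (Fin n → ℝ) → (Fin m → ℝ)) : Prop :=
  Continuous f ∧
    ∃ (r : ℕ) (P : Fin r → Set (Fin n → ℝ)),
      (∀ i, IsPolyhedron (P i)) ∧ (⋃ i, P i) = Set.univ ∧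
      ∀ i, ∃ (A : Matrix (Fin m) (Fin n) ℝ) (b : Fin m → ℝ), ∀ x ∈ P i, f x = A *ᵥ x + b

/-- The Jacobian rank: the largest rank of the Jacobian of `f` at a point of `Ω` where `f` is
differentiable (a supremum in `ℕ` of a set that is bounded by `m`). -/
def jacobianRank {n m : ℕ} (Ω : Set (Fin n → ℝ)) (f : (Fin n → ℝ) → (Fin m → ℝ)) : ℕ :=
  sSup {r : ℕ | ∃ x ∈ Ω, DifferentiableAt ℝ f x ∧
    r = Module.finrank ℝ (LinearMap.range (fderiv ℝ f x : (Fin n → ℝ) →ₗ[ℝ] (Fin m → ℝ)))}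

/-- The bottleneck rank: the smallest `k` such that `f = g ∘ h` on `Ω` for finite piecewise linear
functions `g`, `h` with inner dimension `k`. -/
def bottleneckRank {n m : ℕ} (Ω : Set (Fin n → ℝ)) (f : (Fin n → ℝ) → (Fin m → ℝ)) : ℕ :=
  sInf {k : ℕ | ∃ (h : (Fin n → ℝ) → (Fin k → ℝ)) (g : (Fin k → ℝ) → (Fin m → ℝ)),
    IsFPLF h ∧ IsFPLF g ∧ ∀ x ∈ Ω, f x = g (h x)}

end

/-!
The lower bound is a volume argument. A matrix `W` multiplies the squared `r`-dimensional volume of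
a parallelepiped by at most `exp (‖W‖² - r)` (`det_gram_mul_le`): after a reduction to orthonormal
columns this is `∏ λᵢ ≤ exp (∑ (λᵢ - 1))` for the eigenvalues of a Gram matrix. The slopes of `σ_a`
have absolute value at most `1`, so on a small open set a network `N` of depth `L` is affine and its
linear part multiplies such volumes by at most `exp (‖N‖² - L r)` (`Net.exists_affine_on_open`). If
`N` agrees with `f` near a point where the derivative of `f` has rank `r`, this linear part is that
derivative, which has a fixed nonzero effect on the volume of some parallelepiped. Hence
`‖N‖² ≥ L r - C` with `C` independent of `N` and `L` (`IsFPLF.exists_le_sqNorm`).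

The upper bounds and the inequalities for compositions and sums come from surgery on networks that
costs only an additive constant. By `σ_a(y) - σ_a(-y) = (1 + a) y`, an intermediate result `y` passes
through a nonlinearity as the pair `(s y, -s y)`, and the scale `s` can be chosen so that either the
inner or the outer network keeps its cost exactly (`Net.exists_comp_left`, `Net.exists_comp_right`);
constants and bounded changes of depth disappear after division by `L`. Every finite piecewise linear
function is computed by some network (`IsFPLF.realizable`), because it is a maximum of minima of its
affine pieces (`max_min_induction`). Finally the identity of `ℝᵏ` on a bounded set, shifted into the
positive orthant, where `σ_a` is the identity, costs `k` per layer (`upperLimitCost_id_le`), so that a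
factorization through `ℝᵏ` gives the bound `k`. For an affine function the two bounds meet.
-/

/-! ### Gram determinants -/

/-- This is `∏ λᵢ ≤ ∏ exp (λᵢ - 1)` for the eigenvalues `λᵢ ≥ 0`. -/
theorem det_le_exp_trace_sub_card {r : Type*} [Fintype r] [DecidableEq r] {M : Matrix r r ℝ}
    (hM : M.PosSemidef) : M.det ≤ Real.exp (M.trace - Fintype.card r) := by
  rw [hM.1.det_eq_prod_eigenvalues, hM.1.trace_eq_sum_eigenvalues]
  have : ∑ i, hM.1.eigenvalues i - (Fintype.card r : ℝ) =
      ∑ i, (hM.1.eigenvalues i - 1) := by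
    simp [Finset.sum_sub_distrib]
  simp only [RCLike.ofReal_real_eq_id, id_eq]
  rw [this, Real.exp_sum]
  refine Finset.prod_le_prod (fun i _ => hM.eigenvalues_nonneg i) fun i _ => ?_
  have := Real.add_one_le_exp (hM.1.eigenvalues i - 1)
  linarith

theorem trace_transpose_mul_self {p q : Type*} [Fintype p] [Fintype q] (W : Matrix p q ℝ) :
    (Wᵀ * W).trace = ∑ i, ∑ j, W i j ^ 2 := by
  rw [Finset.sum_comm]
  simp [Matrix.trace, Matrix.mul_apply, pow_two]

theorem trace_gram_mul_le_of_orthonormal {p q r : Type*} [Fintype p] [Fintype q] [Fintype r]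
    [DecidableEq q] [DecidableEq r] (W : Matrix p q ℝ) {V : Matrix q r ℝ} (hV : Vᵀ * V = 1) :
    ((W * V)ᵀ * (W * V)).trace ≤ (Wᵀ * W).trace := by
  set P : Matrix q q ℝ := 1 - V * Vᵀ with hP
  have hPt : Pᵀ = P := by simp [hP]
  have hPP : P * P = P := by
    have : V * Vᵀ * (V * Vᵀ) = V * Vᵀ := by
      rw [Matrix.mul_assoc, ← Matrix.mul_assoc Vᵀ, hV, Matrix.one_mul]
    simp [hP, mul_sub, sub_mul, this]
  have h0 : 0 ≤ ((W * P)ᵀ * (W * P)).trace := by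
    rw [trace_transpose_mul_self]; positivity
  have h1 : ((W * P)ᵀ * (W * P)).trace = (Wᵀ * W).trace - ((W * V)ᵀ * (W * V)).trace := by
    rw [Matrix.transpose_mul, hPt, Matrix.trace_mul_comm, Matrix.mul_assoc, ← Matrix.mul_assoc P,
      hPP, hP, Matrix.sub_mul, Matrix.mul_sub, Matrix.trace_sub, Matrix.one_mul,
      Matrix.trace_mul_comm W, Matrix.trace_mul_comm (W * V)ᵀ, Matrix.transpose_mul]
    simp only [Matrix.mul_assoc]
  linarith

open scoped MatrixOrder Matrix.Norms.L2Operator in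
/-- The Gram determinant of `W U` in terms of that of `U`: a matrix `W` of Frobenius norm
`‖W‖` multiplies `r`-dimensional squared volumes by at most `exp (‖W‖² - r)`. -/
theorem det_gram_mul_le {p q r : Type*} [Fintype p] [Fintype q] [Fintype r]
    [DecidableEq q] [DecidableEq r] (W : Matrix p q ℝ) (U : Matrix q r ℝ) :
    ((W * U)ᵀ * (W * U)).det ≤
      Real.exp ((∑ i, ∑ j, W i j ^ 2) - Fintype.card r) * (Uᵀ * U).det := by
  by_cases h : (Uᵀ * U).det = 0
  · obtain ⟨v, hv, hv0⟩ := Matrix.exists_mulVec_eq_zero_iff.mpr h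
    have hU : U *ᵥ v = 0 := by
      rw [← Matrix.conjTranspose_eq_transpose_of_trivial] at hv0
      exact (Matrix.conjTranspose_mul_self_mulVec_eq_zero U v).mp hv0
    have : ((W * U)ᵀ * (W * U)).det = 0 := by
      refine Matrix.exists_mulVec_eq_zero_iff.mp ⟨v, hv, ?_⟩
      rw [← Matrix.mulVec_mulVec, ← Matrix.mulVec_mulVec, hU]; simp
    rw [this, h, mul_zero]
  · -- write `Uᵀ U = Bᵀ B`, so that `V = U B⁻¹` has orthonormal columns
    obtain ⟨B, hB⟩ := CStarAlgebra.nonneg_iff_eq_star_mul_self.mp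
      (Matrix.posSemidef_conjTranspose_mul_self U).nonneg
    simp only [Matrix.star_eq_conjTranspose, Matrix.conjTranspose_eq_transpose_of_trivial] at hB
    have hdet : (Uᵀ * U).det = B.det * B.det := by rw [hB]; simp
    have hBu : IsUnit B.det := by
      rw [isUnit_iff_ne_zero]; intro h0; rw [hdet, h0, zero_mul] at h; exact h rfl
    have hBB : B⁻¹ * B = 1 := Matrix.nonsing_inv_mul B hBu
    have hBB' : B * B⁻¹ = 1 := Matrix.mul_nonsing_inv B hBu
    set V := U * B⁻¹ with hVdef
    have hUV : U = V * B := by rw [hVdef, Matrix.mul_assoc, hBB, Matrix.mul_one]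
    have hV : Vᵀ * V = 1 := by
      rw [hVdef, Matrix.transpose_mul, Matrix.mul_assoc, ← Matrix.mul_assoc Uᵀ, hB,
        Matrix.mul_assoc, hBB', Matrix.mul_one, ← Matrix.transpose_mul, hBB', Matrix.transpose_one]
    have h1 : ((W * U)ᵀ * (W * U)).det = ((W * V)ᵀ * (W * V)).det * (Uᵀ * U).det := by
      rw [hdet]
      have : (W * U)ᵀ * (W * U) = Bᵀ * ((W * V)ᵀ * (W * V)) * B := by
        rw [hUV]; simp only [Matrix.transpose_mul, Matrix.mul_assoc]
      rw [this]; simp only [Matrix.det_mul, Matrix.det_transpose]; ring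
    rw [h1]
    have h2 : 0 ≤ (Uᵀ * U).det := by rw [hdet]; exact mul_self_nonneg _
    refine mul_le_mul_of_nonneg_right ?_ h2
    have hps : ((W * V)ᵀ * (W * V)).PosSemidef := by
      simpa using Matrix.posSemidef_conjTranspose_mul_self (W * V)
    refine (det_le_exp_trace_sub_card hps).trans (Real.exp_le_exp.mpr ?_)
    have := trace_gram_mul_le_of_orthonormal W hV
    rw [trace_transpose_mul_self W] at this
    linarith

/-! ### Volume growth along a network -/

theorem exists_open_subset_const_sign {X ι : Type*} [TopologicalSpace X] [Finite ι]
    {φ : ι → X → ℝ} (hφ : ∀ i, Continuous (φ i)) {U : Set X} (hU : IsOpen U) (hne : U.Nonempty) :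
    ∃ V ⊆ U, IsOpen V ∧ V.Nonempty ∧ ∀ i, (∀ x ∈ V, 0 ≤ φ i x) ∨ ∀ x ∈ V, φ i x < 0 := by
  classical
  have := Fintype.ofFinite ι
  suffices H : ∀ s : Finset ι, ∃ V ⊆ U, IsOpen V ∧ V.Nonempty ∧
      ∀ i ∈ s, (∀ x ∈ V, 0 ≤ φ i x) ∨ ∀ x ∈ V, φ i x < 0 by simpa using H Finset.univ
  intro s
  induction s using Finset.induction_on with
  | empty => exact ⟨U, subset_rfl, hU, hne, by simp⟩
  | insert j s _ ih =>
    obtain ⟨V, hVU, hVo, hVn, hV⟩ := ih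
    by_cases h : ∀ x ∈ V, 0 ≤ φ j x
    · refine ⟨V, hVU, hVo, hVn, fun i hi => ?_⟩
      rcases Finset.mem_insert.mp hi with rfl | hi
      exacts [Or.inl h, hV i hi]
    · push Not at h
      obtain ⟨x, hx, hx0⟩ := h
      refine ⟨V ∩ {x | φ j x < 0}, Set.inter_subset_left.trans hVU,
        hVo.inter (isOpen_lt (hφ j) continuous_const), ⟨x, hx, hx0⟩, fun i hi => ?_⟩
      rcases Finset.mem_insert.mp hi with rfl | hi
      · exact Or.inr fun y hy => hy.2
      · exact (hV i hi).imp (fun h y hy => h y hy.1) fun h y hy => h y hy.1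

/-- Every nonempty open set has a nonempty open subset on which a network is affine, `x ↦ B x + c'`,
and there the linear part `B` expands `r`-dimensional squared volumes by at most
`exp (‖N‖² - L r)`. The affine map `x ↦ M x + c` in front of the network makes the induction on the
depth go through. -/
theorem Net.exists_affine_on_open {a : ℝ} (ha : |a| ≤ 1) {n m L : ℕ} (N : Net n m L) {n₀ : ℕ}
    (M : Matrix (Fin n) (Fin n₀) ℝ) (c : Fin n → ℝ) {U : Set (Fin n₀ → ℝ)}
    (hU : IsOpen U) (hne : U.Nonempty) :
    ∃ V ⊆ U, IsOpen V ∧ V.Nonempty ∧ ∃ (B : Matrix (Fin m) (Fin n₀) ℝ) (c' : Fin m → ℝ),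
      (∀ x ∈ V, N.eval a (M *ᵥ x + c) = B *ᵥ x + c') ∧
      ∀ (r : ℕ) (X : Matrix (Fin n₀) (Fin r) ℝ), ((B * X)ᵀ * (B * X)).det ≤
        Real.exp (N.sqNorm - L * r) * ((M * X)ᵀ * (M * X)).det := by
  have hdet : ∀ {p r : ℕ} (Y : Matrix (Fin p) (Fin r) ℝ), 0 ≤ (Yᵀ * Y).det := fun Y => by
    simpa using (Matrix.posSemidef_conjTranspose_mul_self Y).det_nonneg
  induction N generalizing U with
  | @output n m W b =>
    refine ⟨U, subset_rfl, hU, hne, W * M, W *ᵥ c + b, fun x _ => ?_, fun r X => ?_⟩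
    · simp only [Net.eval, Matrix.mulVec_add, Matrix.mulVec_mulVec, add_assoc]
    · rw [Matrix.mul_assoc]
      refine (det_gram_mul_le W (M * X)).trans (mul_le_mul_of_nonneg_right ?_ (hdet _))
      rw [Real.exp_le_exp, Net.sqNorm, Fintype.card_fin, Nat.cast_one, one_mul]
      have : 0 ≤ ∑ i, b i ^ 2 := by positivity
      linarith
  | @layer n k m L W b N ih =>
    have hφ : ∀ i, Continuous fun x : Fin n₀ → ℝ => (W *ᵥ (M *ᵥ x + c) + b) i := fun i => by
      have : Continuous fun x : Fin n₀ → ℝ => (W *ᵥ (M *ᵥ x + c) + b) := by fun_prop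
      exact (continuous_apply i).comp this
    obtain ⟨V, hVU, hVo, hVn, hV⟩ := exists_open_subset_const_sign hφ hU hne
    -- the slope of the nonlinearity at each neuron is constant on `V`
    have hd : ∀ i, ∃ d : ℝ, d ^ 2 ≤ 1 ∧ ∀ x ∈ V, leaky a ((W *ᵥ (M *ᵥ x + c) + b) i) =
        d * (W *ᵥ (M *ᵥ x + c) + b) i := fun i => by
      rcases hV i with h | h
      · exact ⟨1, by norm_num, fun x hx => by rw [leaky, if_pos (h x hx), one_mul]⟩
      · exact ⟨a, (sq_le_one_iff_abs_le_one a).mpr ha,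
          fun x hx => by rw [leaky, if_neg (not_le.mpr (h x hx))]⟩
    choose d hd1 hd using hd
    obtain ⟨V', hV'V, hV'o, hV'n, B, c', hB, hX⟩ := ih ((Matrix.diagonal d * W) * M)
      ((Matrix.diagonal d * W) *ᵥ c + Matrix.diagonal d *ᵥ b) hVo hVn
    refine ⟨V', hV'V.trans hVU, hV'o, hV'n, B, c', fun x hx => ?_, fun r X => ?_⟩
    · rw [← hB x hx, Net.eval]
      congr 1
      ext i
      rw [hd i x (hV'V hx), ← Matrix.mulVec_diagonal]
      simp only [Matrix.mulVec_add, Matrix.mulVec_mulVec, Matrix.mul_assoc, add_assoc]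
    · refine (hX r X).trans ?_
      rw [Matrix.mul_assoc]
      refine (mul_le_mul_of_nonneg_left (det_gram_mul_le (Matrix.diagonal d * W) (M * X))
        (Real.exp_pos _).le).trans ?_
      rw [← mul_assoc, ← Real.exp_add]
      refine mul_le_mul_of_nonneg_right (Real.exp_le_exp.mpr ?_) (hdet _)
      have h1 : ∑ i, ∑ j, (Matrix.diagonal d * W) i j ^ 2 ≤ ∑ i, ∑ j, W i j ^ 2 := by
        refine Finset.sum_le_sum fun i _ => Finset.sum_le_sum fun j _ => ?_
        rw [Matrix.diagonal_mul, mul_pow]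
        exact mul_le_of_le_one_left (sq_nonneg _) (hd1 i)
      have h2 : 0 ≤ ∑ i, b i ^ 2 := by positivity
      rw [Net.sqNorm, Fintype.card_fin, Nat.cast_succ]
      linarith

/-! ### Local structure of finite piecewise linear functions -/

theorem IsPolyhedron.isClosed {n : ℕ} {P : Set (Fin n → ℝ)} (hP : IsPolyhedron P) : IsClosed P := by
  obtain ⟨k, C, d, rfl⟩ := hP
  simp only [Set.ofPred_forall]
  refine isClosed_iInter fun i => isClosed_le ?_ continuous_const
  have : Continuous fun x : Fin n → ℝ => C *ᵥ x := by fun_prop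
  exact (continuous_apply i).comp this

theorem IsPolyhedron.convex {n : ℕ} {P : Set (Fin n → ℝ)} (hP : IsPolyhedron P) : Convex ℝ P := by
  obtain ⟨k, C, d, rfl⟩ := hP
  simp only [Set.ofPred_forall]
  refine convex_iInter fun i => ?_
  exact convex_halfSpace_le (f := fun x : Fin n → ℝ => (C *ᵥ x) i)
    ⟨fun x y => by simp [Matrix.mulVec_add], fun c x => by simp [Matrix.mulVec_smul]⟩ (d i)

theorem hasFDerivAt_mulVec_add {n m : ℕ} (A : Matrix (Fin m) (Fin n) ℝ) (b : Fin m → ℝ)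
    (x : Fin n → ℝ) :
    HasFDerivAt (fun y => A *ᵥ y + b) (LinearMap.toContinuousLinearMap A.mulVecLin) x :=
  (LinearMap.toContinuousLinearMap A.mulVecLin).hasFDerivAt.add_const b

theorem matrix_eq_of_affine_eqOn_open {n m : ℕ} {A B : Matrix (Fin m) (Fin n) ℝ} {b c : Fin m → ℝ}
    {W : Set (Fin n → ℝ)} (hW : IsOpen W) (hne : W.Nonempty)
    (h : ∀ y ∈ W, A *ᵥ y + b = B *ᵥ y + c) : A = B := by
  obtain ⟨y, hy⟩ := hne
  have h1 := (hasFDerivAt_mulVec_add A b y).congr_of_eventuallyEq (f₁ := fun y => B *ᵥ y + c)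
    (by filter_upwards [hW.mem_nhds hy] with z hz using (h z hz).symm)
  have h2 := h1.unique (hasFDerivAt_mulVec_add B c y)
  ext1 i j
  have := congrFun (DFunLike.congr_fun h2 (Pi.single j 1)) i
  simpa using this

/-- If `f` is differentiable at `x`, then every affine piece of `f` on an open set close enough to
`x` has the derivative of `f` at `x` as its linear part. -/
theorem IsFPLF.exists_open_fderiv_eq {n m : ℕ} {f : (Fin n → ℝ) → (Fin m → ℝ)} (hf : IsFPLF f)
    {x : Fin n → ℝ} (hx : DifferentiableAt ℝ f x) :
    ∃ U, IsOpen U ∧ x ∈ U ∧ ∀ V ⊆ U, IsOpen V → V.Nonempty →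
      ∀ (B : Matrix (Fin m) (Fin n) ℝ) (c : Fin m → ℝ), (∀ y ∈ V, f y = B *ᵥ y + c) →
        LinearMap.toMatrix' (fderiv ℝ f x : (Fin n → ℝ) →ₗ[ℝ] (Fin m → ℝ)) = B := by
  obtain ⟨-, r, P, hP, hcov, hA⟩ := hf
  -- near `x` only the pieces that contain `x` matter
  refine ⟨⋂ i ∈ {i | x ∉ P i}, (P i)ᶜ, (Set.toFinite _).isOpen_biInter
    fun i _ => (hP i).isClosed.isOpen_compl, by simp, fun V hVU hVo hVn B c hB => ?_⟩
  obtain ⟨y, hyV, hy⟩ := (dense_iUnion_interior_of_closed (fun i => (hP i).isClosed)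
    hcov).inter_open_nonempty V hVo hVn
  obtain ⟨i, hi⟩ := Set.mem_iUnion.mp hy
  have hxi : x ∈ P i := by
    by_contra hxi
    exact Set.mem_iInter₂.mp (hVU hyV) i hxi (interior_subset hi)
  obtain ⟨A, b, hAb⟩ := hA i
  have hWo : IsOpen (V ∩ interior (P i)) := hVo.inter isOpen_interior
  have hAB : A = B := matrix_eq_of_affine_eqOn_open hWo ⟨y, hyV, hi⟩ fun z hz => by
    rw [← hAb z (interior_subset hz.2), hB z hz.1]
  rw [← hAB]
  refine matrix_eq_of_affine_eqOn_open (b := -(fderiv ℝ f x x)) (c := -(A *ᵥ x)) hWo ⟨y, hyV, hi⟩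
    fun z hz => ?_
  have hzP : z ∈ P i := interior_subset hz.2
  rw [LinearMap.toMatrix'_mulVec, ← sub_eq_add_neg, ← sub_eq_add_neg, ← Matrix.mulVec_sub]
  change fderiv ℝ f x z - fderiv ℝ f x x = _
  rw [← map_sub]
  -- both sides are the one-sided derivative of `f` at `x` along the segment from `x` to `z`
  have hline : HasDerivAt (fun t : ℝ => x + t • (z - x)) (z - x) 0 := by
    simpa using ((hasDerivAt_id (0 : ℝ)).smul_const (z - x)).const_add x
  have h1 : HasDerivWithinAt (fun t : ℝ => f (x + t • (z - x))) (fderiv ℝ f x (z - x))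
      (Set.Icc 0 1) 0 := by
    have hfx : HasFDerivAt f (fderiv ℝ f x) (x + (0 : ℝ) • (z - x)) := by
      simpa using hx.hasFDerivAt
    exact (hfx.comp_hasDerivAt 0 hline).hasDerivWithinAt
  have h2 : HasDerivWithinAt (fun t : ℝ => f (x + t • (z - x))) (A *ᵥ (z - x))
      (Set.Icc 0 1) 0 := by
    have h3 := ((hasFDerivAt_mulVec_add A b (x + (0 : ℝ) • (z - x))).comp_hasDerivAt 0
      hline).hasDerivWithinAt (s := Set.Icc 0 1)
    have hseg : ∀ t ∈ Set.Icc (0 : ℝ) 1, f (x + t • (z - x)) = A *ᵥ (x + t • (z - x)) + b :=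
      fun t ht => hAb _ ((hP i).convex.add_smul_sub_mem hxi hzP ht)
    exact h3.congr hseg (hseg 0 (by simp))
  exact (uniqueDiffOn_Icc one_pos 0 (by simp)).eq_deriv _ h1 h2

theorem det_gram_pos {m r : ℕ} {X : Matrix (Fin m) (Fin r) ℝ}
    (h : Function.Injective X.mulVec) : 0 < (Xᵀ * X).det := by
  simpa using (Matrix.PosDef.conjTranspose_mul_self X h).det_pos

theorem exists_matrix_mul_injective {n m r : ℕ} (T : (Fin n → ℝ) →ₗ[ℝ] (Fin m → ℝ))
    (hr : r = Module.finrank ℝ (LinearMap.range T)) :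
    ∃ X : Matrix (Fin n) (Fin r) ℝ, Function.Injective (LinearMap.toMatrix' T * X).mulVec := by
  obtain ⟨g, hg⟩ := T.rangeRestrict.exists_rightInverse_of_surjective
    (LinearMap.range_rangeRestrict T)
  let e : (Fin r → ℝ) ≃ₗ[ℝ] LinearMap.range T := LinearEquiv.ofFinrankEq _ _ (by simp [hr])
  refine ⟨LinearMap.toMatrix' (g ∘ₗ e.toLinearMap), ?_⟩
  have : (LinearMap.toMatrix' T * LinearMap.toMatrix' (g ∘ₗ e.toLinearMap)).mulVec =
      fun v => (e v : Fin m → ℝ) := by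
    ext1 v
    rw [← LinearMap.toMatrix'_comp, LinearMap.toMatrix'_mulVec]
    have := congrArg Subtype.val (LinearMap.congr_fun hg (e v))
    simpa using this
  rw [this]
  exact Subtype.val_injective.comp e.injective

/-- A network of depth `L` that agrees with `f` near a point where the derivative has rank `r` has
squared norm at least `L r`, up to a constant independent of the network and of `L`: the derivative of `f` maps
some `r`-dimensional parallelepiped to one of positive volume. -/
theorem IsFPLF.exists_le_sqNorm {a : ℝ} (ha : |a| ≤ 1) {n m : ℕ} {Ω : Set (Fin n → ℝ)}
    (hΩ : IsOpen Ω) {f : (Fin n → ℝ) → (Fin m → ℝ)} (hf : IsFPLF f) {x : Fin n → ℝ} (hxΩ : x ∈ Ω)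
    (hx : DifferentiableAt ℝ f x) {r : ℕ}
    (hr : r = Module.finrank ℝ (LinearMap.range (fderiv ℝ f x : (Fin n → ℝ) →ₗ[ℝ] (Fin m → ℝ)))) :
    ∃ c : ℝ, ∀ (L : ℕ) (N : Net n m L), (∀ y ∈ Ω, N.eval a y = f y) →
      (L * r : ℝ) + c ≤ N.sqNorm := by
  obtain ⟨X, hX⟩ := exists_matrix_mul_injective _ hr
  obtain ⟨U, hUo, hxU, hU⟩ := hf.exists_open_fderiv_eq hx
  set J := LinearMap.toMatrix' (fderiv ℝ f x : (Fin n → ℝ) →ₗ[ℝ] (Fin m → ℝ))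
  have hX' : Function.Injective X.mulVec := fun u v huv => hX <| by
    simp only [← Matrix.mulVec_mulVec]; exact congrArg (J *ᵥ ·) huv
  have hJX := det_gram_pos hX
  have hXX := det_gram_pos hX'
  refine ⟨Real.log (((J * X)ᵀ * (J * X)).det / (Xᵀ * X).det), fun L N hN => ?_⟩
  obtain ⟨V, hVU, hVo, hVn, B, c', hB, hdet⟩ := N.exists_affine_on_open ha
    (1 : Matrix (Fin n) (Fin n) ℝ) 0 (hUo.inter hΩ) ⟨x, hxU, hxΩ⟩
  have hJB : J = B := hU V (hVU.trans Set.inter_subset_left) hVo hVn B c' fun y hy => by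
    rw [← hB y hy, Matrix.one_mulVec, add_zero, hN y (hVU hy).2]
  have h := hdet r X
  rw [← hJB, Matrix.one_mul, ← div_le_iff₀ hXX, ← Real.log_le_iff_le_exp (by positivity)] at h
  linarith

/-! ### Composition and juxtaposition of networks -/

theorem Net.sqNorm_nonneg {n m L : ℕ} (N : Net n m L) : 0 ≤ N.sqNorm := by
  induction N with
  | output W b => rw [Net.sqNorm]; positivity
  | layer W b N ih => rw [Net.sqNorm]; positivity

/-- The block row `(c W, -c W)`, which maps a concatenated vector `(u, v)` to `c W (u - v)`. -/
noncomputable def diffCols (c : ℝ) {k m : ℕ} (W : Matrix (Fin m) (Fin k) ℝ) :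
    Matrix (Fin m) (Fin (k + k)) ℝ :=
  Matrix.of fun i => Fin.append (c • W i) (-(c • W i))

/-- The block column `(s W; -s W)`, which maps `x` to the concatenated vector
`(s W x, -s W x)`. -/
noncomputable def signedRows (s : ℝ) {k n : ℕ} (W : Matrix (Fin k) (Fin n) ℝ) :
    Matrix (Fin (k + k)) (Fin n) ℝ :=
  Matrix.of (Fin.append (fun i => s • W i) (fun i => -(s • W i)))

/-- The block-diagonal matrix with blocks `W₁` and `W₂`. -/
noncomputable def blockDiag {n₁ m₁ n₂ m₂ : ℕ} (W₁ : Matrix (Fin m₁) (Fin n₁) ℝ)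
    (W₂ : Matrix (Fin m₂) (Fin n₂) ℝ) :
    Matrix (Fin (m₁ + m₂)) (Fin (n₁ + n₂)) ℝ :=
  Matrix.of (Fin.append (fun i => Fin.append (W₁ i) 0) (fun i => Fin.append 0 (W₂ i)))

theorem diffCols_mulVec (c : ℝ) {k m : ℕ} (W : Matrix (Fin m) (Fin k) ℝ) (u v : Fin k → ℝ) :
    diffCols c W *ᵥ Fin.append u v = W *ᵥ (c • (u - v)) := by
  ext i
  simp only [diffCols, Matrix.mulVec, dotProduct, Fin.sum_univ_add, Matrix.of_apply,
    Fin.append_left, Fin.append_right, Pi.smul_apply, Pi.sub_apply, Pi.neg_apply, smul_eq_mul]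
  rw [← Finset.sum_add_distrib]
  exact Finset.sum_congr rfl fun j _ => by ring

theorem sum_sq_diffCols (c : ℝ) {k m : ℕ} (W : Matrix (Fin m) (Fin k) ℝ) :
    ∑ i, ∑ j, diffCols c W i j ^ 2 = 2 * c ^ 2 * ∑ i, ∑ j, W i j ^ 2 := by
  simp only [diffCols, Fin.sum_univ_add, Matrix.of_apply, Fin.append_left, Fin.append_right,
    Pi.neg_apply, Pi.smul_apply, smul_eq_mul, Finset.mul_sum, ← Finset.sum_add_distrib]
  exact Finset.sum_congr rfl fun i _ => Finset.sum_congr rfl fun j _ => by ring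

theorem signedRows_mulVec (s : ℝ) {k n : ℕ} (W : Matrix (Fin k) (Fin n) ℝ) (x : Fin n → ℝ) :
    signedRows s W *ᵥ x = Fin.append (s • (W *ᵥ x)) (-(s • (W *ᵥ x))) := by
  ext i
  refine Fin.addCases (fun i => ?_) (fun i => ?_) i <;>
    simp [signedRows, Matrix.mulVec, dotProduct, Finset.mul_sum, mul_assoc, -Fin.natAdd_eq_addNat]

theorem sum_sq_signedRows (s : ℝ) {k n : ℕ} (W : Matrix (Fin k) (Fin n) ℝ) :
    ∑ i, ∑ j, signedRows s W i j ^ 2 = 2 * s ^ 2 * ∑ i, ∑ j, W i j ^ 2 := by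
  simp only [signedRows, Fin.sum_univ_add, Matrix.of_apply, Fin.append_left, Fin.append_right,
    Pi.neg_apply, Pi.smul_apply, smul_eq_mul, Finset.mul_sum, ← Finset.sum_add_distrib]
  exact Finset.sum_congr rfl fun i _ => Finset.sum_congr rfl fun j _ => by ring

theorem blockDiag_mulVec {n₁ m₁ n₂ m₂ : ℕ} (W₁ : Matrix (Fin m₁) (Fin n₁) ℝ)
    (W₂ : Matrix (Fin m₂) (Fin n₂) ℝ) (x : Fin n₁ → ℝ) (y : Fin n₂ → ℝ) :
    blockDiag W₁ W₂ *ᵥ Fin.append x y = Fin.append (W₁ *ᵥ x) (W₂ *ᵥ y) := by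
  ext i
  refine Fin.addCases (fun i => ?_) (fun i => ?_) i <;>
    simp [blockDiag, Matrix.mulVec, dotProduct, Fin.sum_univ_add]

theorem sum_sq_blockDiag {n₁ m₁ n₂ m₂ : ℕ} (W₁ : Matrix (Fin m₁) (Fin n₁) ℝ)
    (W₂ : Matrix (Fin m₂) (Fin n₂) ℝ) :
    ∑ i, ∑ j, blockDiag W₁ W₂ i j ^ 2 = ∑ i, ∑ j, W₁ i j ^ 2 + ∑ i, ∑ j, W₂ i j ^ 2 := by
  simp [blockDiag, Fin.sum_univ_add]

theorem append_add_append {m n : ℕ} (u u' : Fin m → ℝ) (v v' : Fin n → ℝ) :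
    Fin.append u v + Fin.append u' v' = Fin.append (u + u') (v + v') := by
  ext i
  refine Fin.addCases (fun i => ?_) (fun i => ?_) i <;> simp

theorem leaky_append (a : ℝ) {m n : ℕ} (u : Fin m → ℝ) (v : Fin n → ℝ) :
    (fun i => leaky a (Fin.append u v i)) =
      Fin.append (fun i => leaky a (u i)) (fun i => leaky a (v i)) := by
  ext i
  refine Fin.addCases (fun i => ?_) (fun i => ?_) i <;> simp

/-- The network that reads `2k` inputs `(u, v)` and evaluates `N` at `c (u - v)`. -/
noncomputable def Net.ofDiff (c : ℝ) {k m L : ℕ} : Net k m L → Net (k + k) m L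
  | .output W b => .output (diffCols c W) b
  | .layer W b N => .layer (diffCols c W) b N

theorem Net.eval_ofDiff (a c : ℝ) {k m L : ℕ} (N : Net k m L) (u v : Fin k → ℝ) :
    (N.ofDiff c).eval a (Fin.append u v) = N.eval a (c • (u - v)) := by
  cases N with
  | output W b => simp only [Net.ofDiff, Net.eval, diffCols_mulVec]
  | layer W b N => simp only [Net.ofDiff, Net.eval, diffCols_mulVec]

theorem Net.sqNorm_ofDiff_le {c K : ℝ} (hK : 1 ≤ K) (hc : 2 * c ^ 2 ≤ K) {k m L : ℕ}
    (N : Net k m L) : (N.ofDiff c).sqNorm ≤ K * N.sqNorm := by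
  have key : ∀ s t : ℝ, 0 ≤ s → 0 ≤ t → 2 * c ^ 2 * s + t ≤ K * (s + t) := fun s t hs ht => by
    nlinarith [mul_le_mul_of_nonneg_right hc hs, mul_le_mul_of_nonneg_right hK ht]
  cases N with
  | output W b =>
    simp only [Net.ofDiff, Net.sqNorm, sum_sq_diffCols]
    exact key _ _ (by positivity) (by positivity)
  | layer W b N =>
    simp only [Net.ofDiff, Net.sqNorm, sum_sq_diffCols, add_assoc]
    exact key _ _ (by positivity) (add_nonneg (by positivity) N.sqNorm_nonneg)

/-- The composition of `F` after `G`, of depth the sum of the depths. The output `y` of `G` passes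
through an additional application of the nonlinearity as the pair `(s y, -s y)`, from which `F`
recovers `y` if `c (1 + a) s = 1`. -/
noncomputable def Net.comp (s c : ℝ) {n k m L₁ L₂ : ℕ} (F : Net k m L₂) :
    Net n k L₁ → Net n m (L₂ + L₁)
  | .output W b => .layer (signedRows s W) (Fin.append (s • b) (-(s • b))) (F.ofDiff c)
  | .layer W b G => .layer W b (Net.comp s c F G)

/-- A signed pair of neurons carries a real number through the nonlinearity without loss, as long
as `a ≠ -1`. -/
theorem leaky_sub_leaky_neg (a x : ℝ) : leaky a x - leaky a (-x) = (1 + a) * x := by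
  unfold leaky
  rcases lt_trichotomy x 0 with h | rfl | h
  · rw [if_neg (not_le.mpr h), if_pos (by linarith)]; ring
  · simp
  · rw [if_pos h.le, if_neg (by linarith)]; ring

theorem Net.eval_comp {a s c : ℝ} (h : c * (1 + a) * s = 1) {n k m L₁ L₂ : ℕ} (F : Net k m L₂)
    (G : Net n k L₁) (x : Fin n → ℝ) : (F.comp s c G).eval a x = F.eval a (G.eval a x) := by
  induction G with
  | output W b =>
    simp only [Net.comp, Net.eval]
    rw [signedRows_mulVec, append_add_append, leaky_append, Net.eval_ofDiff]
    congr 1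
    ext i
    have e : (-(s • (W *ᵥ x)) + -(s • b)) i = -((s • (W *ᵥ x) + s • b) i) := by simp; ring
    rw [Pi.smul_apply, Pi.sub_apply, e, leaky_sub_leaky_neg]
    simp only [Pi.add_apply, Pi.smul_apply, smul_eq_mul]
    linear_combination ((W *ᵥ x) i + b i) * h
  | layer W b G ih => rw [Net.comp, Net.eval, Net.eval, ih]

/-- Since only the product of `s` and `c` is prescribed, `K₁` and `K₂` can be traded against each
other: a small `s` allows `K₁ = 1`, a small `c` allows `K₂ = 1`. -/
theorem Net.sqNorm_comp_le {s c K₁ K₂ : ℝ} (hK₁ : 1 ≤ K₁) (hs : 2 * s ^ 2 ≤ K₁) (hK₂ : 1 ≤ K₂)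
    (hc : 2 * c ^ 2 ≤ K₂) {n k m L₁ L₂ : ℕ} (F : Net k m L₂) (G : Net n k L₁) :
    (F.comp s c G).sqNorm ≤ K₁ * G.sqNorm + K₂ * F.sqNorm := by
  induction G with
  | output W b =>
    have hb : ∑ i, (Fin.append (s • b) (-(s • b))) i ^ 2 = 2 * s ^ 2 * ∑ i, b i ^ 2 := by
      simp only [Fin.sum_univ_add, Fin.append_left, Fin.append_right, Pi.neg_apply, Pi.smul_apply,
        smul_eq_mul, Finset.mul_sum, ← Finset.sum_add_distrib]
      exact Finset.sum_congr rfl fun i _ => by ring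
    simp only [Net.comp, Net.sqNorm]
    rw [sum_sq_signedRows, hb, ← mul_add]
    exact add_le_add (mul_le_mul_of_nonneg_right hs (by positivity)) (F.sqNorm_ofDiff_le hK₂ hc)
  | layer W b G ih =>
    rw [Net.comp, Net.sqNorm, Net.sqNorm]
    have h1 : 0 ≤ (∑ i, ∑ j, W i j ^ 2) + ∑ i, b i ^ 2 := by positivity
    linarith [ih F, le_mul_of_one_le_left h1 hK₁, mul_add K₁
      ((∑ i, ∑ j, W i j ^ 2) + ∑ i, b i ^ 2) G.sqNorm]

/-- Composing with a fixed outer network `F` costs an additive constant, uniformly in the inner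
network `G`: it does not multiply the cost of `G`, as a merger of the two affine maps would. -/
theorem Net.exists_comp_left {a : ℝ} (ha : -1 < a) {k m L₂ : ℕ} (F : Net k m L₂) :
    ∃ C : ℝ, ∀ {n L₁ : ℕ} (G : Net n k L₁), ∃ H : Net n m (L₁ + L₂),
      (∀ x, H.eval a x = F.eval a (G.eval a x)) ∧ H.sqNorm ≤ G.sqNorm + C := by
  have h2 : √2 ^ 2 = 2 := Real.sq_sqrt (by norm_num)
  have h2' : 0 < √2 := by positivity
  have ha' : 0 < 1 + a := by linarith
  -- `s = 1 / √2` leaves the cost of the last layer of `G` unchanged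
  set c : ℝ := √2 / (1 + a)
  refine ⟨max 1 (2 * c ^ 2) * F.sqNorm, fun {n L₁} G => ?_⟩
  rw [add_comm L₁]
  refine ⟨F.comp (√2)⁻¹ c G, Net.eval_comp (by simp only [c]; field_simp) F G, ?_⟩
  refine (Net.sqNorm_comp_le le_rfl ?_ (le_max_left _ _) (le_max_right _ _) F G).trans_eq
    (by rw [one_mul])
  rw [inv_pow, h2]; norm_num

/-- Composing with a fixed inner network `G` costs an additive constant, uniformly in the outer
network `F`. -/
theorem Net.exists_comp_right {a : ℝ} (ha : -1 < a) {n k L₁ : ℕ} (G : Net n k L₁) :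
    ∃ C : ℝ, ∀ {m L₂ : ℕ} (F : Net k m L₂), ∃ H : Net n m (L₂ + L₁),
      (∀ x, H.eval a x = F.eval a (G.eval a x)) ∧ H.sqNorm ≤ F.sqNorm + C := by
  have h2 : √2 ^ 2 = 2 := Real.sq_sqrt (by norm_num)
  have h2' : 0 < √2 := by positivity
  have ha' : 0 < 1 + a := by linarith
  -- `c = 1 / √2` leaves the cost of the first layer of `F` unchanged
  set s : ℝ := √2 / (1 + a)
  refine ⟨max 1 (2 * s ^ 2) * G.sqNorm, fun {m L₂} F =>
    ⟨F.comp s (√2)⁻¹ G, Net.eval_comp (by simp only [s]; field_simp) F G, ?_⟩⟩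
  refine (Net.sqNorm_comp_le (le_max_left _ _) (le_max_right _ _) le_rfl ?_ F G).trans_eq
    (by rw [one_mul, add_comm])
  rw [inv_pow, h2]; norm_num

/-- The juxtaposition of two networks of the same depth, with block-diagonal weights; its cost is
exactly the sum of the costs. -/
theorem Net.exists_par (a : ℝ) {n₁ m₁ n₂ m₂ L : ℕ} (N₁ : Net n₁ m₁ L) (N₂ : Net n₂ m₂ L) :
    ∃ N : Net (n₁ + n₂) (m₁ + m₂) L,
      (∀ x y, N.eval a (Fin.append x y) = Fin.append (N₁.eval a x) (N₂.eval a y)) ∧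
      N.sqNorm = N₁.sqNorm + N₂.sqNorm := by
  have hb : ∀ {p q : ℕ} (b₁ : Fin p → ℝ) (b₂ : Fin q → ℝ),
      ∑ i, Fin.append b₁ b₂ i ^ 2 = ∑ i, b₁ i ^ 2 + ∑ i, b₂ i ^ 2 := by simp [Fin.sum_univ_add]
  induction N₁ generalizing n₂ with
  | output W₁ b₁ =>
    cases N₂ with
    | output W₂ b₂ =>
      refine ⟨.output (blockDiag W₁ W₂) (Fin.append b₁ b₂), fun x y => ?_, ?_⟩
      · simp only [Net.eval, blockDiag_mulVec, append_add_append]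
      · simp only [Net.sqNorm, sum_sq_blockDiag, hb]; ring
    | layer W₂ b₂ N₂ => cases N₂
  | layer W₁ b₁ N₁ ih =>
    cases N₂ with
    | output W₂ b₂ => cases N₁
    | layer W₂ b₂ N₂ =>
      obtain ⟨N, hN, hN'⟩ := ih N₂
      refine ⟨.layer (blockDiag W₁ W₂) (Fin.append b₁ b₂) N, fun x y => ?_, ?_⟩
      · simp only [Net.eval, blockDiag_mulVec, append_add_append, leaky_append, hN]
      · simp only [Net.sqNorm, sum_sq_blockDiag, hb, hN']; ring

/-- The addition map on pairs, `(u, v) ↦ u + v`. -/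
noncomputable def addMap (m : ℕ) : (Fin (m + m) → ℝ) →ₗ[ℝ] (Fin m → ℝ) where
  toFun x i := x (Fin.castAdd m i) + x (Fin.natAdd m i)
  map_add' x y := by ext i; simp; ring
  map_smul' c x := by ext i; simp; ring

/-- The diagonal map `x ↦ (x, x)`. -/
noncomputable def diagMap (n : ℕ) : (Fin n → ℝ) →ₗ[ℝ] (Fin (n + n) → ℝ) where
  toFun x := Fin.append x x
  map_add' x y := by rw [append_add_append]
  map_smul' c x := by
    ext i
    refine Fin.addCases (fun i => ?_) (fun i => ?_) i <;>
      simp [-Fin.natAdd_eq_addNat]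

/-- Two networks of the same depth can be added at the cost of a constant. The duplication of the
input and the final addition are separate layers: adding the two output layers directly would add
their biases, whose squared norms are not subadditive. -/
theorem Net.exists_add {a : ℝ} (ha : -1 < a) (n m : ℕ) :
    ∃ C : ℝ, ∀ {L : ℕ} (N₁ N₂ : Net n m L), ∃ N : Net n m (L + 2),
      (∀ x, N.eval a x = N₁.eval a x + N₂.eval a x) ∧
      N.sqNorm ≤ N₁.sqNorm + N₂.sqNorm + C := by
  obtain ⟨C₁, h₁⟩ := Net.exists_comp_left ha (.output (LinearMap.toMatrix' (addMap m)) 0)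
  obtain ⟨C₂, h₂⟩ := Net.exists_comp_right ha (.output (LinearMap.toMatrix' (diagMap n)) 0)
  refine ⟨C₁ + C₂, fun {L} N₁ N₂ => ?_⟩
  obtain ⟨N, hN, hN'⟩ := Net.exists_par a N₁ N₂
  obtain ⟨N', hN₁, hN₁'⟩ := h₁ N
  obtain ⟨N'', hN₂, hN₂'⟩ := h₂ N'
  refine ⟨N'', fun x => ?_, by linarith⟩
  rw [hN₂, hN₁, Net.eval, Net.eval, LinearMap.toMatrix'_mulVec, LinearMap.toMatrix'_mulVec,
    add_zero, add_zero]
  have : diagMap n x = Fin.append x x := rfl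
  rw [this, hN]
  ext i
  simp [addMap, -Fin.natAdd_eq_addNat]

theorem Net.exists_pad {a : ℝ} (ha : -1 < a) {n m L : ℕ} (N : Net n m L) (d : ℕ) :
    ∃ N' : Net n m (L + d), ∀ x, N'.eval a x = N.eval a x := by
  induction d with
  | zero => exact ⟨N, fun _ => rfl⟩
  | succ d ih =>
    obtain ⟨N', hN'⟩ := ih
    obtain ⟨C, hC⟩ := Net.exists_comp_left ha (.output (1 : Matrix (Fin m) (Fin m) ℝ) 0)
    obtain ⟨H, hH, -⟩ := hC N'
    exact ⟨H, fun x => by simp [hH, Net.eval, hN']⟩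

/-! ### Functions computed by networks -/

/-- A function is realizable if some network, of some depth, computes it on the whole space. -/
def Realizable (a : ℝ) {n m : ℕ} (f : (Fin n → ℝ) → (Fin m → ℝ)) : Prop :=
  ∃ (L : ℕ) (N : Net n m L), ∀ x, N.eval a x = f x

namespace Realizable

variable {a : ℝ} {n k m : ℕ}

theorem affine (A : Matrix (Fin m) (Fin n) ℝ) (b : Fin m → ℝ) :
    Realizable a fun x => A *ᵥ x + b :=
  ⟨1, .output A b, fun _ => rfl⟩

theorem linear (A : (Fin n → ℝ) →ₗ[ℝ] (Fin m → ℝ)) : Realizable a A :=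
  ⟨1, .output (LinearMap.toMatrix' A) 0, fun x => by
    rw [Net.eval, LinearMap.toMatrix'_mulVec, add_zero]⟩

theorem comp (ha : -1 < a) {f : (Fin k → ℝ) → (Fin m → ℝ)} {g : (Fin n → ℝ) → (Fin k → ℝ)}
    (hf : Realizable a f) (hg : Realizable a g) : Realizable a fun x => f (g x) := by
  obtain ⟨L₁, F, hF⟩ := hf
  obtain ⟨L₂, G, hG⟩ := hg
  obtain ⟨C, hC⟩ := F.exists_comp_left ha
  obtain ⟨H, hH, -⟩ := hC G
  exact ⟨_, H, fun x => by rw [hH, hG, hF]⟩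

theorem leaky_entrywise : Realizable a fun (x : Fin n → ℝ) i => leaky a (x i) :=
  ⟨2, .layer (1 : Matrix (Fin n) (Fin n) ℝ) 0 (.output (1 : Matrix (Fin n) (Fin n) ℝ) 0),
    fun x => by
      simp only [Net.eval, Matrix.one_mulVec, add_zero]⟩

variable {f g : (Fin n → ℝ) → (Fin m → ℝ)}

theorem add (ha : -1 < a) (hf : Realizable a f) (hg : Realizable a g) : Realizable a (f + g) := by
  obtain ⟨L₁, F, hF⟩ := hf
  obtain ⟨L₂, G, hG⟩ := hg
  obtain ⟨F', hF'⟩ := Net.exists_pad ha F L₂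
  obtain ⟨G', hG'⟩ : ∃ N' : Net n m (L₁ + L₂), ∀ x, N'.eval a x = G.eval a x :=
    add_comm L₂ L₁ ▸ Net.exists_pad ha G L₁
  obtain ⟨C, hC⟩ := Net.exists_add ha n m
  obtain ⟨H, hH, -⟩ := hC F' G'
  exact ⟨_, H, fun x => by rw [hH, hF', hG', hF, hG, Pi.add_apply]⟩

theorem smul (ha : -1 < a) (c : ℝ) (hf : Realizable a f) : Realizable a (c • f) :=
  comp (f := (c • LinearMap.id : (Fin m → ℝ) →ₗ[ℝ] (Fin m → ℝ))) ha (linear _) hf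

/-- The maximum is `f + ReLU(g - f)`, where `ReLU(z) = (σ_a(z) + a σ_a(-z)) / (1 - a²)`. -/
theorem sup (ha₁ : -1 < a) (ha₂ : a < 1) (hf : Realizable a f) (hg : Realizable a g) :
    Realizable a (f ⊔ g) := by
  have hd : Realizable a (g + (-1 : ℝ) • f) := hg.add ha₁ (hf.smul ha₁ _)
  have h1 : Realizable a fun x i => leaky a ((g + (-1 : ℝ) • f) x i) := leaky_entrywise.comp ha₁ hd
  have h2 : Realizable a fun x i => leaky a (((-1 : ℝ) • (g + (-1 : ℝ) • f)) x i) :=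
    leaky_entrywise.comp ha₁ (hd.smul ha₁ _)
  have h := hf.add ha₁ ((h1.add ha₁ (h2.smul ha₁ a)).smul ha₁ (1 - a ^ 2)⁻¹)
  convert h using 1
  have ha : 1 - a ^ 2 ≠ 0 := by nlinarith
  ext x i
  simp only [Pi.sup_apply, Pi.add_apply, Pi.smul_apply, smul_eq_mul, leaky]
  rcases lt_trichotomy (f x i) (g x i) with h | h | h
  · rw [sup_eq_right.mpr h.le, if_pos (by linarith), if_neg (by linarith)]; field_simp; ring
  · rw [h]; simp
  · rw [sup_eq_left.mpr h.le, if_neg (by linarith), if_pos (by linarith)]; ring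

theorem inf (ha₁ : -1 < a) (ha₂ : a < 1) (hf : Realizable a f) (hg : Realizable a g) :
    Realizable a (f ⊓ g) := by
  have h := ((hf.smul ha₁ (-1)).sup ha₁ ha₂ (hg.smul ha₁ (-1))).smul ha₁ (-1)
  convert h using 1
  ext x i
  simp [max_neg_neg]

end Realizable

/-! ### Finite piecewise linear functions are realizable -/

/-- Near `t₀`, only the pieces that pass through the graph at `t₀` are used. -/
theorem eventually_affine_eq_imp {ι : Type*} [Finite ι] {p q : ι → ℝ} {φ : ℝ → ℝ}
    (hφ : Continuous φ) (t₀ : ℝ) :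
    ∀ᶠ t in 𝓝 t₀, ∀ i, φ t = p i + q i * t → φ t₀ = p i + q i * t₀ := by
  rw [eventually_all]
  intro i
  by_cases h : φ t₀ = p i + q i * t₀
  · exact Eventually.of_forall fun _ _ => h
  · have : IsOpen {t | φ t ≠ p i + q i * t} := isOpen_ne_fun hφ (by fun_prop)
    exact (this.eventually_mem h).mono fun t ht h' => absurd h' ht

/-- If no such piece exists, every piece that vanishes on `[0, 1]` is strictly decreasing. Then `φ`
is negative just after `0` and positive just before its next zero, which is absurd. -/
theorem exists_affine_crossing_of_eq_zero {ι : Type*} [Finite ι] {p q : ι → ℝ} {φ : ℝ → ℝ}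
    (hφ : Continuous φ) (h : ∀ t, ∃ i, φ t = p i + q i * t) (h₀ : φ 0 = 0) (h₁ : φ 1 = 0) :
    ∃ i, p i ≤ 0 ∧ 0 ≤ p i + q i := by
  by_contra! hc
  -- the pieces that vanish somewhere on `[0, 1]` are decreasing
  have hq : ∀ t₀ ∈ Set.Icc (0 : ℝ) 1, ∀ i, p i + q i * t₀ = 0 → q i < 0 := fun t₀ ht i hi => by
    by_contra! hq
    have h1 : p i ≤ 0 := by nlinarith [mul_nonneg hq ht.1]
    have := hc i h1
    nlinarith [mul_nonneg hq (sub_nonneg.mpr ht.2)]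
  obtain ⟨t₁, ⟨ht₁, ht₁'⟩, hφt₁⟩ : ∃ t ∈ Set.Ioo (0 : ℝ) 1, φ t < 0 := by
    have e1 : ∀ᶠ t in 𝓝[>] (0 : ℝ), t ∈ Set.Ioo (0 : ℝ) 1 := Ioo_mem_nhdsGT one_pos
    obtain ⟨t, ht, hev⟩ := (e1.and
      ((eventually_affine_eq_imp (p := p) (q := q) hφ 0).filter_mono nhdsWithin_le_nhds)).exists
    obtain ⟨i, hi⟩ := h t
    have hi0 := hev i hi
    rw [h₀] at hi0
    have := hq 0 (by simp) i hi0.symm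
    refine ⟨t, ht, ?_⟩
    rw [hi]
    nlinarith [mul_pos_of_neg_of_neg this (neg_lt_zero.mpr ht.1)]
  -- the first zero after `t₁`
  set S : Set ℝ := Set.Icc t₁ 1 ∩ {t | φ t = 0} with hS
  have hSc : IsClosed S := isClosed_Icc.inter (isClosed_eq hφ continuous_const)
  have hSb : BddBelow S := ⟨t₁, fun t ht => ht.1.1⟩
  have hsS : sInf S ∈ S := hSc.csInf_mem ⟨1, ⟨ht₁'.le, le_rfl⟩, h₁⟩ hSb
  set s := sInf S
  have hs : t₁ < s := lt_of_le_of_ne hsS.1.1 fun e => by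
    have : φ s = 0 := hsS.2
    rw [← e] at this
    exact hφt₁.ne this
  have e1 : ∀ᶠ t in 𝓝[<] s, t ∈ Set.Ioo t₁ s := Ioo_mem_nhdsLT hs
  obtain ⟨t, ht, hev⟩ := (e1.and
    ((eventually_affine_eq_imp (p := p) (q := q) hφ s).filter_mono nhdsWithin_le_nhds)).exists
  obtain ⟨i, hi⟩ := h t
  have his := hev i hi
  rw [show φ s = 0 from hsS.2] at his
  have hqi := hq s ⟨ht₁.le.trans hs.le, hsS.1.2⟩ i his.symm
  have hpos : 0 < φ t := by
    rw [hi]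
    nlinarith [mul_pos_of_neg_of_neg hqi (sub_neg.mpr ht.2)]
  obtain ⟨t', ht', h0⟩ := intermediate_value_Icc ht.1.le hφ.continuousOn ⟨hφt₁.le, hpos.le⟩
  have : s ≤ t' := csInf_le hSb ⟨⟨ht'.1, (ht'.2.trans ht.2.le).trans hsS.1.2⟩, h0⟩
  linarith [ht'.2, ht.2]

/-- A continuous function on the line that is pieced together from finitely many affine functions
`t ↦ p i + q i t` has a piece below it at `0` and above it at `1`. -/
theorem exists_affine_crossing {ι : Type*} [Finite ι] {p q : ι → ℝ} {φ : ℝ → ℝ}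
    (hφ : Continuous φ) (h : ∀ t, ∃ i, φ t = p i + q i * t) :
    ∃ i, p i ≤ φ 0 ∧ φ 1 ≤ p i + q i := by
  obtain ⟨i, h1, h2⟩ := exists_affine_crossing_of_eq_zero
    (p := fun i => p i - φ 0) (q := fun i => q i - (φ 1 - φ 0))
    (φ := fun t => φ t - φ 0 - (φ 1 - φ 0) * t) (by fun_prop)
    (fun t => (h t).imp fun i hi => by rw [hi]; ring) (by ring) (by ring)
  exact ⟨i, by linarith, by linarith⟩

/-- A continuous function `f` that is pieced together from finitely many affine functions `ℓ i` is
in the lattice generated by them: `f x` is the maximum over `y` of the minimum of the `ℓ i x` with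
`ℓ i y ≥ f y`. Only finitely many sets of indices `i` occur as `y` varies. -/
theorem max_min_induction {n r : ℕ} {f : (Fin n → ℝ) → ℝ} (hf : Continuous f)
    {w : Fin r → Fin n → ℝ} {c : Fin r → ℝ} (h : ∀ x, ∃ i, f x = w i ⬝ᵥ x + c i)
    {p : ((Fin n → ℝ) → ℝ) → Prop} (hsup : ∀ u, p u → ∀ v, p v → p (u ⊔ v))
    (hinf : ∀ u, p u → ∀ v, p v → p (u ⊓ v)) (hp : ∀ i, p fun x => w i ⬝ᵥ x + c i) : p f := by
  classical
  set ℓ : Fin r → (Fin n → ℝ) → ℝ := fun i x => w i ⬝ᵥ x + c i with hℓ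
  -- for the piece between two points, restrict to the segment from `x` to `y`
  have key : ∀ x y, ∃ i, ℓ i x ≤ f x ∧ f y ≤ ℓ i y := fun x y => by
    obtain ⟨i, h1, h2⟩ := exists_affine_crossing (p := fun i => ℓ i x)
      (q := fun i => w i ⬝ᵥ (y - x)) (φ := fun t : ℝ => f (x + t • (y - x))) (by fun_prop)
      (fun t => (h (x + t • (y - x))).imp fun i hi => by
        rw [hi, hℓ, dotProduct_add, dotProduct_smul, smul_eq_mul]; ring)
    refine ⟨i, by simpa using h1, ?_⟩
    have e : ℓ i x + w i ⬝ᵥ (y - x) = ℓ i y := by rw [hℓ]; simp only [dotProduct_sub]; ring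
    have h3 : f (x + (1 : ℝ) • (y - x)) ≤ ℓ i x + w i ⬝ᵥ (y - x) := h2
    rwa [e, one_smul, add_sub_cancel] at h3
  let S : (Fin n → ℝ) → Finset (Fin r) := fun y => Finset.univ.filter fun i => f y ≤ ℓ i y
  have hS : ∀ y, (S y).Nonempty := fun y => by
    obtain ⟨i, -, hi⟩ := key y y
    exact ⟨i, by simp [S, hi]⟩
  let T := {s : Finset (Fin r) // ∃ y, S y = s}
  have hT : ∀ s : T, s.1.Nonempty := fun ⟨s, y, hy⟩ => hy ▸ hS y
  have : Nonempty T := ⟨⟨S 0, 0, rfl⟩⟩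
  have hfe : f = Finset.univ.sup' Finset.univ_nonempty fun s : T => s.1.inf' (hT s) ℓ := by
    ext x
    rw [Finset.sup'_apply]
    refine le_antisymm ?_ (Finset.sup'_le _ _ ?_)
    · refine le_trans ?_ (Finset.le_sup' (fun s : T => s.1.inf' (hT s) ℓ x)
        (Finset.mem_univ ⟨S x, x, rfl⟩))
      rw [Finset.inf'_apply]
      exact Finset.le_inf' _ _ fun i hi => (Finset.mem_filter.mp hi).2
    · rintro ⟨_, y, rfl⟩ -
      obtain ⟨i, hx, hy⟩ := key x y
      rw [Finset.inf'_apply]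
      exact (Finset.inf'_le (fun i => ℓ i x) (by simp [S, hy])).trans hx
  rw [hfe]
  exact Finset.sup'_induction _ _ hsup fun s _ => Finset.inf'_induction _ _ hinf fun i _ => hp i

theorem IsFPLF.realizable {a : ℝ} (ha₁ : -1 < a) (ha₂ : a < 1) {n m : ℕ}
    {f : (Fin n → ℝ) → (Fin m → ℝ)} (hf : IsFPLF f) : Realizable a f := by
  obtain ⟨hc, r, P, -, hP, hA⟩ := hf
  choose A b hAb using hA
  have hcoord : ∀ j, Realizable a fun x (_ : Fin 1) => f x j := fun j => by
    refine max_min_induction (f := fun x => f x j) (w := fun i => A i j) (c := fun i => b i j)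
      (p := fun u => Realizable a fun x (_ : Fin 1) => u x)
      ((continuous_apply j).comp hc) (fun x => ?_) (fun u hu v hv => hu.sup ha₁ ha₂ hv)
      (fun u hu v hv => hu.inf ha₁ ha₂ hv) fun i => ?_
    · obtain ⟨i, hi⟩ := Set.mem_iUnion.mp (hP ▸ Set.mem_univ x)
      exact ⟨i, by rw [hAb i x hi]; rfl⟩
    · exact Realizable.affine (Matrix.of fun _ : Fin 1 => A i j) fun _ => b i j
  have hsum : f = ∑ j, fun x => (LinearMap.single ℝ (fun _ : Fin m => ℝ) j ∘ₗ
      LinearMap.proj (0 : Fin 1)) fun _ : Fin 1 => f x j := by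
    ext x i
    simp [Finset.sum_apply, Pi.single_apply]
  rw [hsum]
  refine Finset.sum_induction _ (Realizable a) (fun u v hu hv => hu.add ha₁ hv) ?_ fun j _ => ?_
  · convert Realizable.affine (a := a) (0 : Matrix (Fin m) (Fin n) ℝ) 0 using 1
    ext x; simp
  · exact Realizable.comp ha₁ (Realizable.linear _) (hcoord j)

/-! ### Limits in the depth -/

theorem ENNReal.liminf_add_le_liminf_add_limsup {ι : Type*} {F : Filter ι} (u v : ι → ℝ≥0∞) :
    liminf (fun i => u i + v i) F ≤ liminf u F + limsup v F := by
  refine ENNReal.le_of_forall_pos_le_add fun ε hε hfin => ?_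
  obtain ⟨h1, h2⟩ := ENNReal.add_lt_top.mp hfin
  have hε2 : ((ε / 2 : NNReal) : ℝ≥0∞) ≠ 0 := by simpa using hε.ne'
  have e1 := frequently_lt_of_liminf_lt (f := F) (by isBoundedDefault)
    (ENNReal.lt_add_right h1.ne hε2)
  have e2 := eventually_lt_of_limsup_lt (ENNReal.lt_add_right h2.ne hε2)
  refine liminf_le_of_frequently_le ((e1.and_eventually e2).mono fun i hi => ?_)
  calc u i + v i ≤ _ := add_le_add hi.1.le hi.2.le
    _ = liminf u F + limsup v F + (((ε / 2 : NNReal) : ℝ≥0∞) + ((ε / 2 : NNReal) : ℝ≥0∞)) := by ring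
    _ = _ := by rw [← ENNReal.coe_add, add_halves]

theorem ENNReal.limsup_add_le_limsup_add_limsup {ι : Type*} {F : Filter ι} (u v : ι → ℝ≥0∞) :
    limsup (fun i => u i + v i) F ≤ limsup u F + limsup v F := by
  refine ENNReal.le_of_forall_pos_le_add fun ε hε hfin => ?_
  obtain ⟨h1, h2⟩ := ENNReal.add_lt_top.mp hfin
  have hε2 : ((ε / 2 : NNReal) : ℝ≥0∞) ≠ 0 := by simpa using hε.ne'
  have e1 := eventually_lt_of_limsup_lt (ENNReal.lt_add_right h1.ne hε2)
  have e2 := eventually_lt_of_limsup_lt (ENNReal.lt_add_right h2.ne hε2)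
  refine limsup_le_of_le (by isBoundedDefault) ((e1.and e2).mono fun i hi => ?_)
  calc u i + v i ≤ _ := add_le_add hi.1.le hi.2.le
    _ = limsup u F + limsup v F + (((ε / 2 : NNReal) : ℝ≥0∞) + ((ε / 2 : NNReal) : ℝ≥0∞)) := by ring
    _ = _ := by rw [← ENNReal.coe_add, add_halves]

theorem tendsto_const_div_natCast_atTop {C : ℝ≥0∞} (hC : C ≠ ∞) :
    Tendsto (fun L : ℕ => C / (L : ℝ≥0∞)) atTop (𝓝 0) := by
  simpa [div_eq_mul_inv] using
    ENNReal.Tendsto.const_mul ENNReal.tendsto_inv_nat_nhds_zero (Or.inr hC)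

theorem shift_div_le {u v : ℕ → ℝ≥0∞} {c : ℕ} {C : ℝ≥0∞} (h : ∀ L, u (L + c) ≤ v L + C) (L : ℕ) :
    u (L + c) / ((L + c : ℕ) : ℝ≥0∞) ≤ v L / (L : ℝ≥0∞) + C / (L : ℝ≥0∞) := by
  rw [← ENNReal.add_div]
  exact ENNReal.div_le_div (h L) (by exact_mod_cast Nat.le_add_right L c)

/-- A bounded shift of the depth and a bounded additional cost do not matter for the cost per
layer. -/
theorem liminf_div_le_of_shift {u v : ℕ → ℝ≥0∞} {c : ℕ} {C : ℝ≥0∞} (hC : C ≠ ∞)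
    (h : ∀ L, u (L + c) ≤ v L + C) :
    liminf (fun L : ℕ => u L / (L : ℝ≥0∞)) atTop ≤
      liminf (fun L : ℕ => v L / (L : ℝ≥0∞)) atTop := by
  rw [← liminf_nat_add _ c, ← ENNReal.liminf_add_of_right_tendsto_zero
    (tendsto_const_div_natCast_atTop hC) fun L : ℕ => v L / (L : ℝ≥0∞)]
  exact liminf_le_liminf (Eventually.of_forall (shift_div_le h))

theorem limsup_div_le_of_shift {u v : ℕ → ℝ≥0∞} {c : ℕ} {C : ℝ≥0∞} (hC : C ≠ ∞)
    (h : ∀ L, u (L + c) ≤ v L + C) :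
    limsup (fun L : ℕ => u L / (L : ℝ≥0∞)) atTop ≤
      limsup (fun L : ℕ => v L / (L : ℝ≥0∞)) atTop := by
  rw [← limsup_nat_add _ c, ← ENNReal.limsup_add_of_right_tendsto_zero
    (tendsto_const_div_natCast_atTop hC) fun L : ℕ => v L / (L : ℝ≥0∞)]
  exact limsup_le_limsup (Eventually.of_forall (shift_div_le h))

/-! ### Representation costs of compositions and sums -/

section

variable {a : ℝ} {n m k : ℕ} {Ω : Set (Fin n → ℝ)}

theorem repCost_le {f : (Fin n → ℝ) → (Fin m → ℝ)} {L : ℕ} {N : Net n m L} {c : ℝ}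
    (hN : ∀ x ∈ Ω, N.eval a x = f x) (hc : N.sqNorm ≤ c) :
    repCost a Ω f L ≤ ENNReal.ofReal c :=
  (iInf₂_le N hN).trans (ENNReal.ofReal_le_ofReal hc)

theorem le_repCost_add {f : (Fin n → ℝ) → (Fin m → ℝ)} {L : ℕ} {b c : ℝ≥0∞}
    (h : ∀ N : Net n m L, (∀ x ∈ Ω, N.eval a x = f x) → b ≤ ENNReal.ofReal N.sqNorm + c) :
    b ≤ repCost a Ω f L + c := by
  simp only [repCost, ENNReal.iInf_add]
  exact le_iInf₂ h

theorem repCost_congr {f g : (Fin n → ℝ) → (Fin m → ℝ)} (h : ∀ x ∈ Ω, f x = g x) :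
    repCost a Ω f = repCost a Ω g := by
  ext L
  unfold repCost
  congr! 4 with N
  exact imp_congr_right fun hx => by rw [h _ hx]

theorem repCost_le_add_of_net {n' m' : ℕ} {Ω' : Set (Fin n' → ℝ)} {f : (Fin n → ℝ) → (Fin m → ℝ)}
    {g : (Fin n' → ℝ) → (Fin m' → ℝ)} {L L' : ℕ} {C : ℝ}
    (h : ∀ N : Net n m L, (∀ x ∈ Ω, N.eval a x = f x) → ∃ N' : Net n' m' L',
      (∀ x ∈ Ω', N'.eval a x = g x) ∧ N'.sqNorm ≤ N.sqNorm + C) :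
    repCost a Ω' g L' ≤ repCost a Ω f L + ENNReal.ofReal C :=
  le_repCost_add fun N hN => by
    obtain ⟨N', hN', hC⟩ := h N hN
    exact (repCost_le hN' hC).trans ENNReal.ofReal_add_le

theorem repCost_comp_le_inner (ha : -1 < a) {f : (Fin k → ℝ) → (Fin m → ℝ)}
    {g : (Fin n → ℝ) → (Fin k → ℝ)} (hf : Realizable a f) :
    ∃ (d : ℕ) (C : ℝ), ∀ L, repCost a Ω (f ∘ g) (L + d) ≤ repCost a Ω g L + ENNReal.ofReal C := by
  obtain ⟨d, F, hF⟩ := hf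
  obtain ⟨C, hC⟩ := F.exists_comp_left ha
  refine ⟨d, C, fun L => repCost_le_add_of_net fun G hG => ?_⟩
  obtain ⟨H, hH, hHC⟩ := hC G
  exact ⟨H, fun x hx => by rw [hH, hG x hx, hF, Function.comp_apply], hHC⟩

theorem repCost_comp_le_outer (ha : -1 < a) {f : (Fin k → ℝ) → (Fin m → ℝ)}
    {g : (Fin n → ℝ) → (Fin k → ℝ)} (hg : Realizable a g) :
    ∃ (d : ℕ) (C : ℝ), ∀ L,
      repCost a Ω (f ∘ g) (L + d) ≤ repCost a (g '' Ω) f L + ENNReal.ofReal C := by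
  obtain ⟨d, G, hG⟩ := hg
  obtain ⟨C, hC⟩ := G.exists_comp_right ha
  refine ⟨d, C, fun L => repCost_le_add_of_net fun F hF => ?_⟩
  obtain ⟨H, hH, hHC⟩ := hC F
  exact ⟨H, fun x hx => by
    rw [hH, hG, hF _ (Set.mem_image_of_mem g hx), Function.comp_apply], hHC⟩

theorem limitCost_comp_le_inner (ha : -1 < a) {f : (Fin k → ℝ) → (Fin m → ℝ)}
    {g : (Fin n → ℝ) → (Fin k → ℝ)} (hf : Realizable a f) :
    lowerLimitCost a Ω (f ∘ g) ≤ lowerLimitCost a Ω g ∧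
      upperLimitCost a Ω (f ∘ g) ≤ upperLimitCost a Ω g := by
  obtain ⟨d, C, h⟩ := repCost_comp_le_inner (Ω := Ω) (g := g) ha hf
  exact ⟨liminf_div_le_of_shift ENNReal.ofReal_ne_top h,
    limsup_div_le_of_shift ENNReal.ofReal_ne_top h⟩

theorem limitCost_comp_le_outer (ha : -1 < a) {f : (Fin k → ℝ) → (Fin m → ℝ)}
    {g : (Fin n → ℝ) → (Fin k → ℝ)} (hg : Realizable a g) :
    lowerLimitCost a Ω (f ∘ g) ≤ lowerLimitCost a (g '' Ω) f ∧
      upperLimitCost a Ω (f ∘ g) ≤ upperLimitCost a (g '' Ω) f := by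
  obtain ⟨d, C, h⟩ := repCost_comp_le_outer (Ω := Ω) (f := f) ha hg
  exact ⟨liminf_div_le_of_shift ENNReal.ofReal_ne_top h,
    limsup_div_le_of_shift ENNReal.ofReal_ne_top h⟩

theorem repCost_add_le (ha : -1 < a) (f g : (Fin n → ℝ) → (Fin m → ℝ)) :
    ∃ C : ℝ, ∀ L, repCost a Ω (f + g) (L + 2) ≤
      (repCost a Ω f L + repCost a Ω g L) + ENNReal.ofReal C := by
  obtain ⟨C, hC⟩ := Net.exists_add ha n m
  refine ⟨C, fun L => ?_⟩
  rw [add_assoc]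
  refine le_repCost_add fun F hF => ?_
  rw [add_left_comm]
  refine le_repCost_add fun G hG => ?_
  obtain ⟨H, hH, hHC⟩ := hC F G
  rw [← add_assoc, ← ENNReal.ofReal_add G.sqNorm_nonneg F.sqNorm_nonneg, add_comm G.sqNorm]
  exact (repCost_le (fun x hx => by rw [hH, hF x hx, hG x hx, Pi.add_apply]) hHC).trans
    ENNReal.ofReal_add_le

theorem limitCost_add_le (ha : -1 < a) (f g : (Fin n → ℝ) → (Fin m → ℝ)) :
    lowerLimitCost a Ω (f + g) ≤ lowerLimitCost a Ω f + upperLimitCost a Ω g ∧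
      upperLimitCost a Ω (f + g) ≤ upperLimitCost a Ω f + upperLimitCost a Ω g := by
  obtain ⟨C, h⟩ := repCost_add_le (Ω := Ω) ha f g
  have h1 := liminf_div_le_of_shift ENNReal.ofReal_ne_top h
  have h2 := limsup_div_le_of_shift ENNReal.ofReal_ne_top h
  simp only [ENNReal.add_div] at h1 h2
  exact ⟨h1.trans (ENNReal.liminf_add_le_liminf_add_limsup _ _),
    h2.trans (ENNReal.limsup_add_le_limsup_add_limsup _ _)⟩

/-! ### Upper bounds: the identity costs its dimension in every layer -/

theorem sum_sq_one (k : ℕ) : ∑ i, ∑ j, (1 : Matrix (Fin k) (Fin k) ℝ) i j ^ 2 = k := by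
  simp [Matrix.one_apply]

/-- On the nonnegative orthant the nonlinearity is the identity, so a translation there costs `k`
per layer, in any depth. -/
theorem Net.exists_translation (a : ℝ) {k : ℕ} (c : Fin k → ℝ) (L : ℕ) :
    ∃ N : Net k k (L + 1), (∀ y, (∀ i, 0 ≤ y i) → N.eval a y = y + c) ∧
      N.sqNorm = (L + 1) * k + ∑ i, c i ^ 2 := by
  induction L with
  | zero =>
    refine ⟨.output (1 : Matrix (Fin k) (Fin k) ℝ) c, fun y _ => ?_, ?_⟩
    · rw [Net.eval, Matrix.one_mulVec]
    · rw [Net.sqNorm, sum_sq_one]; simp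
  | succ L ih =>
    obtain ⟨N, hN, hN'⟩ := ih
    refine ⟨.layer (1 : Matrix (Fin k) (Fin k) ℝ) 0 N, fun y hy => ?_, ?_⟩
    · have : (fun i => leaky a (((1 : Matrix (Fin k) (Fin k) ℝ) *ᵥ y + 0) i)) = y := by
        ext i; rw [Matrix.one_mulVec, add_zero, leaky, if_pos (hy i)]
      rw [Net.eval, this, hN y hy]
    · rw [Net.sqNorm, sum_sq_one, hN']; simp; ring

theorem limsup_natCast_mul_div_le (k : ℕ) :
    limsup (fun L : ℕ => ((L : ℝ≥0∞) * k) / (L : ℝ≥0∞)) atTop ≤ k := by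
  refine limsup_le_of_le (by isBoundedDefault) (Eventually.of_forall fun L => ?_)
  exact ENNReal.div_le_of_le_mul (by rw [mul_comm])

theorem upperLimitCost_id_le {S : Set (Fin k → ℝ)} (hS : Bornology.IsBounded S) :
    upperLimitCost a S id ≤ k := by
  obtain ⟨R, hR⟩ := hS.exists_norm_le
  -- the first layer shifts `S` into the positive orthant, the last one shifts it back
  set c : Fin k → ℝ := fun _ => R with hc
  refine le_trans (limsup_div_le_of_shift (v := fun L : ℕ => (L : ℝ≥0∞) * k) (c := 2)
    (C := ENNReal.ofReal (2 * k + 2 * ∑ i, c i ^ 2)) ENNReal.ofReal_ne_top fun L => ?_)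
    (limsup_natCast_mul_div_le k)
  obtain ⟨N, hN, hN'⟩ := Net.exists_translation a (-c) L
  have e : (L : ℝ≥0∞) * k = ENNReal.ofReal (L * k) := by
    rw [ENNReal.ofReal_mul (by positivity)]; simp
  rw [e, ← ENNReal.ofReal_add (by positivity) (by positivity)]
  refine repCost_le (N := .layer (1 : Matrix (Fin k) (Fin k) ℝ) c N) (fun y hy => ?_) ?_
  · have hpos : ∀ i, 0 ≤ (y + c) i := fun i => by
      have := (norm_le_pi_norm y i).trans (hR y hy)
      rw [Real.norm_eq_abs] at this
      rw [Pi.add_apply, hc]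
      linarith [neg_abs_le (y i)]
    have : (fun i => leaky a (((1 : Matrix (Fin k) (Fin k) ℝ) *ᵥ y + c) i)) = y + c := by
      ext i; rw [Matrix.one_mulVec, leaky, if_pos (hpos i)]
    rw [Net.eval, this, hN _ hpos, id, add_neg_cancel_right]
  · rw [Net.sqNorm, sum_sq_one, hN']
    simp only [Pi.neg_apply, neg_sq]
    linarith

theorem IsFPLF.affine (A : Matrix (Fin m) (Fin n) ℝ) (b : Fin m → ℝ) :
    IsFPLF fun x => A *ᵥ x + b :=
  ⟨by fun_prop, 1, fun _ => Set.univ, fun _ => ⟨0, 0, 0, by ext; simp⟩, Set.iUnion_const _,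
    fun _ => ⟨A, b, fun _ _ => rfl⟩⟩

theorem upperLimitCost_le_of_factorization (ha₁ : -1 < a) (ha₂ : a < 1)
    (hΩ : Bornology.IsBounded Ω) {f : (Fin n → ℝ) → (Fin m → ℝ)} {h : (Fin n → ℝ) → (Fin k → ℝ)}
    {g : (Fin k → ℝ) → (Fin m → ℝ)} (hh : IsFPLF h) (hg : IsFPLF g)
    (hf : ∀ x ∈ Ω, f x = g (h x)) : upperLimitCost a Ω f ≤ k := by
  have hb : Bornology.IsBounded (h '' Ω) :=
    (hΩ.isCompact_closure.image hh.1).isBounded.subset (Set.image_mono subset_closure)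
  have e : upperLimitCost a Ω f = upperLimitCost a Ω (g ∘ h) := by
    unfold upperLimitCost
    rw [repCost_congr (g := g ∘ h) hf]
  rw [e]
  calc _ ≤ upperLimitCost a Ω (id ∘ h) :=
        (limitCost_comp_le_inner ha₁ (hg.realizable ha₁ ha₂)).2
    _ ≤ upperLimitCost a (h '' Ω) id :=
        (limitCost_comp_le_outer ha₁ (hh.realizable ha₁ ha₂)).2
    _ ≤ k := upperLimitCost_id_le hb

theorem upperLimitCost_le_bottleneckRank (ha₁ : -1 < a) (ha₂ : a < 1)
    (hΩ : Bornology.IsBounded Ω) {f : (Fin n → ℝ) → (Fin m → ℝ)} (hf : IsFPLF f) :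
    upperLimitCost a Ω f ≤ bottleneckRank Ω f := by
  have hne : {k : ℕ | ∃ (h : (Fin n → ℝ) → (Fin k → ℝ)) (g : (Fin k → ℝ) → (Fin m → ℝ)),
      IsFPLF h ∧ IsFPLF g ∧ ∀ x ∈ Ω, f x = g (h x)}.Nonempty :=
    ⟨n, _, f, IsFPLF.affine 1 0, hf, fun x _ => by simp⟩
  obtain ⟨h, g, hh, hg, hfgh⟩ := Nat.sInf_mem hne
  exact upperLimitCost_le_of_factorization ha₁ ha₂ hΩ hh hg hfgh

theorem upperLimitCost_affine_le_rank (ha₁ : -1 < a) (ha₂ : a < 1) (hΩ : Bornology.IsBounded Ω)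
    (A : Matrix (Fin m) (Fin n) ℝ) (b : Fin m → ℝ) :
    upperLimitCost a Ω (fun x => A *ᵥ x + b) ≤ A.rank := by
  let e : (Fin A.rank → ℝ) ≃ₗ[ℝ] LinearMap.range A.mulVecLin :=
    LinearEquiv.ofFinrankEq _ _ (by rw [Module.finrank_fin_fun]; rfl)
  refine upperLimitCost_le_of_factorization ha₁ ha₂ hΩ
    (IsFPLF.affine (LinearMap.toMatrix' (e.symm.toLinearMap ∘ₗ A.mulVecLin.rangeRestrict)) 0)
    (IsFPLF.affine (LinearMap.toMatrix' ((LinearMap.range A.mulVecLin).subtype ∘ₗ e.toLinearMap)) b)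
    fun x _ => ?_
  simp only [LinearMap.toMatrix'_mulVec, add_zero]
  simp

/-! ### Lower bounds -/

theorem le_lowerLimitCost_of_differentiableAt (ha : |a| ≤ 1) (hΩ : IsOpen Ω)
    {f : (Fin n → ℝ) → (Fin m → ℝ)} (hf : IsFPLF f) {x : Fin n → ℝ} (hxΩ : x ∈ Ω)
    (hx : DifferentiableAt ℝ f x) {r : ℕ}
    (hr : r = Module.finrank ℝ (LinearMap.range (fderiv ℝ f x : (Fin n → ℝ) →ₗ[ℝ] (Fin m → ℝ)))) :
    (r : ℝ≥0∞) ≤ lowerLimitCost a Ω f := by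
  obtain ⟨c, hc⟩ := hf.exists_le_sqNorm ha hΩ hxΩ hx hr
  have ht : Tendsto (fun L : ℕ => ENNReal.ofReal (r + c / L)) atTop (𝓝 (r : ℝ≥0∞)) := by
    have := (tendsto_const_div_atTop_nhds_zero_nat c).const_add (r : ℝ)
    simpa using ENNReal.tendsto_ofReal this
  rw [← ht.liminf_eq]
  refine liminf_le_liminf ?_
  filter_upwards [eventually_gt_atTop 0] with L hL
  have hL' : (0 : ℝ) < L := by exact_mod_cast hL
  rw [ENNReal.le_div_iff_mul_le (by simp [hL.ne']) (by simp), ← ENNReal.ofReal_natCast,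
    ← ENNReal.ofReal_mul' hL'.le]
  refine le_iInf₂ fun N hN => ENNReal.ofReal_le_ofReal ?_
  refine le_trans (le_of_eq ?_) (hc L N hN)
  field_simp

theorem finrank_range_le (T : (Fin n → ℝ) →ₗ[ℝ] (Fin m → ℝ)) :
    Module.finrank ℝ (LinearMap.range T) ≤ m := by
  simpa using Submodule.finrank_le (LinearMap.range T)

theorem jacobianRank_le_lowerLimitCost (ha : |a| ≤ 1) (hΩ : IsOpen Ω)
    {f : (Fin n → ℝ) → (Fin m → ℝ)} (hf : IsFPLF f) :
    (jacobianRank Ω f : ℝ≥0∞) ≤ lowerLimitCost a Ω f := by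
  rcases Set.eq_empty_or_nonempty {r : ℕ | ∃ x ∈ Ω, DifferentiableAt ℝ f x ∧
    r = Module.finrank ℝ (LinearMap.range (fderiv ℝ f x : (Fin n → ℝ) →ₗ[ℝ] (Fin m → ℝ)))}
    with h | h
  · rw [jacobianRank, h]; simp
  · obtain ⟨x, hxΩ, hx, hr⟩ := Nat.sSup_mem h
      ⟨m, by rintro _ ⟨x, -, -, rfl⟩; exact finrank_range_le _⟩
    exact le_lowerLimitCost_of_differentiableAt ha hΩ hf hxΩ hx hr

theorem rank_le_lowerLimitCost_affine (ha : |a| ≤ 1) (hΩ : IsOpen Ω) (hne : Ω.Nonempty)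
    (A : Matrix (Fin m) (Fin n) ℝ) (b : Fin m → ℝ) :
    (A.rank : ℝ≥0∞) ≤ lowerLimitCost a Ω fun x => A *ᵥ x + b := by
  obtain ⟨x, hx⟩ := hne
  have hd := hasFDerivAt_mulVec_add A b x
  refine le_lowerLimitCost_of_differentiableAt ha hΩ (IsFPLF.affine A b) hx hd.differentiableAt ?_
  rw [hd.fderiv]
  rfl

end

theorem theorem1 (a : ℝ) (ha₁ : -1 < a) (ha₂ : a < 1) {n : ℕ} (Ω : Set (Fin n → ℝ))
    (hΩ_open : IsOpen Ω) (hΩ_bdd : Bornology.IsBounded Ω) (hΩ_ne : Ω.Nonempty) :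
    -- the sandwich bound
    (∀ (m : ℕ) (f : (Fin n → ℝ) → (Fin m → ℝ)), IsFPLF f →
      (jacobianRank Ω f : ℝ≥0∞) ≤ lowerLimitCost a Ω f ∧
      lowerLimitCost a Ω f ≤ upperLimitCost a Ω f ∧
      upperLimitCost a Ω f ≤ (bottleneckRank Ω f : ℝ≥0∞)) ∧
    -- compositions
    (∀ (k m : ℕ) (g : (Fin n → ℝ) → (Fin k → ℝ)) (f : (Fin k → ℝ) → (Fin m → ℝ)),
      IsFPLF g → IsFPLF f →
      lowerLimitCost a Ω (f ∘ g) ≤ min (lowerLimitCost a (g '' Ω) f) (lowerLimitCost a Ω g) ∧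
      upperLimitCost a Ω (f ∘ g) ≤ min (upperLimitCost a (g '' Ω) f) (upperLimitCost a Ω g)) ∧
    -- sums
    (∀ (m : ℕ) (f g : (Fin n → ℝ) → (Fin m → ℝ)), IsFPLF f → IsFPLF g →
      lowerLimitCost a Ω (f + g) ≤ lowerLimitCost a Ω f + upperLimitCost a Ω g ∧
      upperLimitCost a Ω (f + g) ≤ upperLimitCost a Ω f + upperLimitCost a Ω g) ∧
    -- affine functions
    (∀ (m : ℕ) (A : Matrix (Fin m) (Fin n) ℝ) (b : Fin m → ℝ),
      Tendsto (fun L : ℕ => repCost a Ω (fun x => A *ᵥ x + b) L / (L : ℝ≥0∞)) atTop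
        (𝓝 (A.rank : ℝ≥0∞))) := by
  have ha : |a| ≤ 1 := abs_le.mpr ⟨ha₁.le, ha₂.le⟩
  refine ⟨fun m f hf => ⟨jacobianRank_le_lowerLimitCost ha hΩ_open hf, liminf_le_limsup,
      upperLimitCost_le_bottleneckRank ha₁ ha₂ hΩ_bdd hf⟩, fun k m g f hg hf => ?_,
    fun m f g _ _ => limitCost_add_le ha₁ f g, fun m A b => ?_⟩
  · have h₁ := limitCost_comp_le_inner (Ω := Ω) (g := g) ha₁ (hf.realizable ha₁ ha₂)
    have h₂ := limitCost_comp_le_outer (Ω := Ω) (f := f) ha₁ (hg.realizable ha₁ ha₂)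
    exact ⟨le_min h₂.1 h₁.1, le_min h₂.2 h₁.2⟩
  · exact tendsto_of_le_liminf_of_limsup_le
      (rank_le_lowerLimitCost_affine ha hΩ_open hΩ_ne A b)
      (upperLimitCost_affine_le_rank ha₁ ha₂ hΩ_bdd A b)
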